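/- **Setting.** Let $A,D\ge 1$. In each round $t=1,2,\dots$ a learner plays an arm $a(t)\in[A]=\{1,\dots,A\}$ and observes a reward vector $r(t)\in\mathbb R^D$ with $r^i(t)=\mu^i_{a(t)}+\kappa^i(t)$. Given the previous rounds and $a(t)=a$, the noise vector $\kappa(t)$ is drawn from a fixed distribution $\nu_a$ on $\mathbb R^D$ whose coordinates have mean zero and are 1-sub-Gaussian, i.e. $\mathbb E[e^{\lambda\kappa^i(t)}\mid a(t)=a]\le e^{\lambda^2/2}$ for all $\lambda\in\mathbb R$ (they may be dependent across objectives). The learner knows thresholds $\eta_1,\dots,\eta_D\in\mathbb R$. Let $\mathcal S^i_s=\{a:\mu_a^i<\eta_i\}$ be the set of arms that are not satisficing in objective $i$. Assume that some arm $*$ is satisficing in all objectives, $\mu_*^i\ge\eta_i$ for all $i$, fix such an arm, and put $\Delta_a^i=\mu_*^i-\mu_a^i$, $\delta_i=\mu_*^i-\eta_i$ (so that $\Delta_a^i-\delta_i=\eta_i-\mu_a^i$). The satisficing regret in objective $i$ is $$\mathrm{Reg}^i_s(T)=\sum_{t=1}^T(\Delta^i_{a(t)}-\delta_i)\,\mathbb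 I\{a(t)\in\mathcal S_s^i\}.$$ **NOM-LEX.** Let $N_a(t)$ be the number of plays of $a$ before round $t$ and $\hat\mu_a^i(t)$ the sample mean of the rewards of $a$ in objective $i$ observed before round $t$. First play the arms $1,\dots,A$ once each, in this order. After that, let $$\hat{\mathcal A}_*(t)=\Bigl\{a:\ \hat\mu^i_a(t)-\eta_i>-\sqrt{4\log N_a(t)/N_a(t)}\ \text{ for all } i\in[D]\Bigr\}.$$ If $\hat{\mathcal A}_*(t)\ne\emptyset$, play an arm of $\hat{\mathcal A}_*(t)$ chosen uniformly at random and go on to round $t+1$; if $\hat{\mathcal A}_*(t)=\emptyset$, play the arms $1,\dots,A$ in rounds $t,\dots,t+A-1$ and go on to round $t+A$. **Theorem.** When NOM-LEX is run, for all $i\in[D]$ and $T\ge 1$, with $M_a:=\max_{j\in[D]}(\Delta_a^j-\delta_j)$, $$\mathbb E[\mathrm{Reg}^i_s(T)]\le\sum_{a\in\mathcal S_s^i}\left(\Bigl(\frac{\pi^2}{6}D+1\Bigr)(\Delta_a^i-\delta_i)+\frac{36}{M_a}\,\max\Bigl\{\log\frac{17}{M_a},\,0\Bigr\}\right).$$ Moreover,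 if $D=1$, the positive part is not needed: omitting the objective index, $$\mathbb E[\mathrm{Reg}_s(T)]\le\sum_{a\in\mathcal S_s}\left(\Bigl(\frac{\pi^2}{6}+1\Bigr)(\Delta_a-\delta)+\frac{36}{\Delta_a-\delta}\log\frac{17}{\Delta_a-\delta}\right).$$ The bounds do not depend on $T$, so the expected satisficing regret is bounded in time. -/

import Mathlib

open MeasureTheory ProbabilityTheory
open scoped ENNReal

/-- A stochastic `D`-objective bandit with arms `Fin A`. Playing arm `a` yields the reward vector
`mean a + κ`, where the noise vector `κ` has law `noise a`. The noise has mean zero and is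
`1`-sub-Gaussian in each objective; it may be dependent across objectives. -/
structure BanditEnv (A D : ℕ) where
  mean : Fin A → Fin D → ℝ
  noise : Fin A → Measure (Fin D → ℝ)
  noise_prob : ∀ a, IsProbabilityMeasure (noise a)
  noise_mean : ∀ a i, ∫ x, x i ∂(noise a) = 0
  noise_subG : ∀ a i, HasSubgaussianMGF (fun x : Fin D → ℝ => x i) 1 (noise a)

namespace BanditEnv

variable {A D : ℕ}

/-- `star` is satisficing in every objective: `η i ≤ μ_star^i` for all `i`. -/
def IsSatisficingOptimal (env : BanditEnv A D) (η : Fin D → ℝ) (star : Fin A) : Prop :=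
  ∀ i, η i ≤ env.mean star i

/-- The gap `Δ_a^i = μ_star^i - μ_a^i` with respect to the arm `star`. -/
def gap (env : BanditEnv A D) (star a : Fin A) (i : Fin D) : ℝ :=
  env.mean star i - env.mean a i

/-- `δ_i = μ_star^i - η_i`. -/
def delta (env : BanditEnv A D) (η : Fin D → ℝ) (star : Fin A) (i : Fin D) : ℝ :=
  env.mean star i - η i

/-- `max_j (Δ_a^j - δ_j)`; for `D ≥ 1` this supremum over a finite index set is a maximum. -/
noncomputable def maxGap (env : BanditEnv A D) (η : Fin D → ℝ) (star a : Fin A) : ℝ :=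
  ⨆ j : Fin D, (env.gap star a j - env.delta η star j)

open Classical in
/-- The set of arms that are satisficing in objective `i`. -/
noncomputable def satisficing (env : BanditEnv A D) (η : Fin D → ℝ) (i : Fin D) :
    Finset (Fin A) :=
  {a | η i ≤ env.mean a i}

/-- The set of arms that are not satisficing in objective `i`. -/
noncomputable def nonSatisficing (env : BanditEnv A D) (η : Fin D → ℝ) (i : Fin D) :
    Finset (Fin A) :=
  Finset.univ \ env.satisficing η i

/-- The satisficing regret in objective `i` of a sequence of arms over its first `T` rounds. -/
noncomputable def satRegret (env : BanditEnv A D) (η : Fin D → ℝ) (star : Fin A) (i : Fin D)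
    (T : ℕ) (arm : ℕ → Fin A) : ℝ :=
  ∑ t ∈ Finset.range T,
    if arm t ∈ env.nonSatisficing η i then env.gap star (arm t) i - env.delta η star i else 0

end BanditEnv

/-! The algorithm. Rounds are numbered from `0`, so that index `t` is the `(t+1)`-st round. In a play
`h`, the pair `h t` consists of the arm played in round `t` and the reward vector observed there.
The quantities "at the beginning of round `t`" depend on `h s` for `s < t` only. -/

namespace NomLex

variable {A D : ℕ}

/-- `N_a(t)`: number of plays of arm `a` before round `t`. -/
def count (h : ℕ → Fin A × (Fin D → ℝ)) (t : ℕ) (a : Fin A) : ℕ :=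
  ((Finset.range t).filter (fun s => (h s).1 = a)).card

/-- Sample mean of the rewards of arm `a` in objective `i` observed before round `t`. -/
noncomputable def empMean (h : ℕ → Fin A × (Fin D → ℝ)) (t : ℕ) (a : Fin A) (i : Fin D) : ℝ :=
  (∑ s ∈ (Finset.range t).filter (fun s => (h s).1 = a), (h s).2 i) / (count h t a : ℝ)

open Classical in
/-- The set of estimated satisficing optimal arms at the beginning of round `t`. It is computed
from the shifted rewards `r^i - η_i`, whose sample mean is `empMean - η i`. -/
noncomputable def candidates (η : Fin D → ℝ) (h : ℕ → Fin A × (Fin D → ℝ)) (t : ℕ) :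
    Finset (Fin A) :=
  {a | ∀ i, empMean h t a i - η i >
    -Real.sqrt (4 * Real.log (count h t a : ℝ) / (count h t a : ℝ))}

open Classical in
/-- Number of arms that remain to be played, at the beginning of round `t`, in the current
round-robin sweep through all arms (`0` if no sweep is going on). There is an initial sweep, and a
new one starts in a round that is outside a sweep and has no candidate arm. -/
noncomputable def sweepLeft (η : Fin D → ℝ) (h : ℕ → Fin A × (Fin D → ℝ)) : ℕ → ℕ
  | 0 => A
  | t + 1 =>
    if 0 < sweepLeft η h t then sweepLeft η h t - 1
    else if (candidates η h t).Nonempty then 0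
    else A - 1

open Classical in
/-- The probability with which NOM-LEX plays arm `k` in round `t`, given the previous rounds: in a
sweep, the next arm in the order `0, …, A - 1`; outside a sweep, a uniformly random candidate arm
if there is one, and otherwise arm `0`, as the first arm of a new sweep. -/
noncomputable def playProb (η : Fin D → ℝ) (h : ℕ → Fin A × (Fin D → ℝ)) (t : ℕ) (k : Fin A) :
    ℝ≥0∞ :=
  if 0 < sweepLeft η h t then (if (k : ℕ) = A - sweepLeft η h t then 1 else 0)
  else if (candidates η h t).Nonempty then
    (if k ∈ candidates η h t then ((candidates η h t).card : ℝ≥0∞)⁻¹ else 0)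
  else (if (k : ℕ) = 0 then 1 else 0)

end NomLex

/-- The σ-algebra generated by the arms played and the rewards observed before round `t`. -/
abbrev historySigma {A D : ℕ} {Ω : Type*} (arm : ℕ → Ω → Fin A) (rew : ℕ → Ω → Fin D → ℝ) (t : ℕ) :
    MeasurableSpace Ω :=
  MeasurableSpace.comap (fun (ω : Ω) (s : Fin t) => (arm s ω, rew s ω)) inferInstance

/-- The arms `arm` and reward vectors `rew`, random variables on a probability space `(Ω, P)`, are
those of a run of NOM-LEX with thresholds `η` in the bandit `env`. -/
structure IsNomLexRun {A D : ℕ} (env : BanditEnv A D) (η : Fin D → ℝ) {Ω : Type*}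
    [MeasurableSpace Ω] (P : Measure Ω) (arm : ℕ → Ω → Fin A) (rew : ℕ → Ω → Fin D → ℝ) :
    Prop where
  measurable_arm : ∀ t, Measurable (arm t)
  measurable_rew : ∀ t, Measurable (rew t)
  /-- Given the previous rounds, arm `k` is played with probability `playProb`. -/
  arm_law : ∀ t k H, MeasurableSet[historySigma arm rew t] H →
    P (H ∩ {ω | arm t ω = k}) =
      ∫⁻ ω in H, NomLex.playProb η (fun s => (arm s ω, rew s ω)) t k ∂P
  /-- Given the previous rounds and the arm `k` that is played, the noise has law `noise k`. -/
  noise_law : ∀ t k H B, MeasurableSet[historySigma arm rew t] H → MeasurableSet B →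
    P (H ∩ {ω | arm t ω = k} ∩ {ω | rew t ω - env.mean k ∈ B}) =
      P (H ∩ {ω | arm t ω = k}) * env.noise k B

/-! By linearity the regret is a sum over non-satisficing arms of gap times number of plays, so it
suffices to bound the expected plays of one arm `a` (`IsNomLexRun.integral_count_le`).

The count is bounded pathwise. A play of `a` is either part of a sweep or a free choice among
candidates. A sweep after the initial one starts only if the good arm `star` is not a candidate, and
it raises the count of `star`; a free play requires `a` to be a candidate and raises its own count.
Up to one initial play, the count is therefore at most the number of sample sizes `n` at which
`star` fails its test plus the number at which `a` passes it (`NomLex.count_le_card_add_card`).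
Summing over sample sizes instead of rounds makes the bound independent of `T`.

Since sampling is adaptive, the sum of the first `n` noises of an arm is handled by an exponential
supermartingale, which shows it to be sub-Gaussian with parameter `n`
(`IsNomLexRun.hasSubgaussianMGF_stoppedNoise`). The test radius makes `star` fail at size `n` with
probability at most `1 / n ^ 2` per objective, whence `π ^ 2 / 6 * D`. Arm `a` passes with
exponentially small probability once the radius is below two thirds of its gap `M`, whence `36 / M ^
2 * log (17 / M)`.

For `M > 17` that logarithm is negative. The bound survives because the Chernoff estimate at `n = 2`
can be improved by `0.03`, using that the noise is centred. -/

/-! ### Sub-Gaussian noise under adaptive sampling. -/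

section Noise

variable {A D : ℕ} {Ω : Type*}

/-- The history of play as a sequence of pairs of arms and rewards. -/
def playHistory (arm : ℕ → Ω → Fin A) (rew : ℕ → Ω → Fin D → ℝ) (ω : Ω) (s : ℕ) :
    Fin A × (Fin D → ℝ) := (arm s ω, rew s ω)

/-- The sum, over the first `n` plays of arm `a` among the rounds before `t`, of the noise in
objective `j`. -/
def stoppedNoise (env : BanditEnv A D) (h : ℕ → Fin A × (Fin D → ℝ)) (a : Fin A) (j : Fin D)
    (n t : ℕ) : ℝ :=
  ∑ s ∈ Finset.range t,
    if (h s).1 = a ∧ NomLex.count h s a < n then (h s).2 j - env.mean a j else 0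

lemma NomLex.count_eq_sum (h : ℕ → Fin A × (Fin D → ℝ)) (t : ℕ) (a : Fin A) :
    NomLex.count h t a = ∑ s ∈ Finset.range t, if (h s).1 = a then 1 else 0 := by
  exact Finset.card_filter _ _

lemma NomLex.count_zero (h : ℕ → Fin A × (Fin D → ℝ)) (a : Fin A) : NomLex.count h 0 a = 0 := by
  simp [NomLex.count]

lemma NomLex.count_succ (h : ℕ → Fin A × (Fin D → ℝ)) (t : ℕ) (a : Fin A) :
    NomLex.count h (t + 1) a = NomLex.count h t a + if (h t).1 = a then 1 else 0 := by
  rw [NomLex.count_eq_sum, NomLex.count_eq_sum, Finset.sum_range_succ]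

lemma stoppedNoise_succ (env : BanditEnv A D) (h : ℕ → Fin A × (Fin D → ℝ)) (a : Fin A)
    (j : Fin D) (n t : ℕ) :
    stoppedNoise env h a j n (t + 1) = stoppedNoise env h a j n t +
      if (h t).1 = a ∧ NomLex.count h t a < n then (h t).2 j - env.mean a j else 0 := by
  simp [stoppedNoise, Finset.sum_range_succ]

/-- The σ-algebra is arbitrary because both the ambient one and `historySigma` are needed, here and
in the measurability lemmas below. -/
lemma measurable_count {m : MeasurableSpace Ω} {arm : ℕ → Ω → Fin A}
    (rew : ℕ → Ω → Fin D → ℝ) {t : ℕ} (harm : ∀ s < t, Measurable (arm s)) (a : Fin A) :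
    Measurable fun ω => NomLex.count (playHistory arm rew ω) t a := by
  simp only [NomLex.count_eq_sum, playHistory]
  refine Finset.measurable_fun_sum _ fun s hs => Measurable.ite ?_ measurable_const measurable_const
  exact harm s (Finset.mem_range.1 hs) (measurableSet_singleton a)

lemma measurable_stoppedNoise {m : MeasurableSpace Ω} (env : BanditEnv A D) {arm : ℕ → Ω → Fin A}
    {rew : ℕ → Ω → Fin D → ℝ} {t : ℕ} (harm : ∀ s < t, Measurable (arm s))
    (hrew : ∀ s < t, Measurable (rew s)) (a : Fin A) (j : Fin D) (n : ℕ) :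
    Measurable fun ω => stoppedNoise env (playHistory arm rew ω) a j n t := by
  simp only [stoppedNoise]
  refine Finset.measurable_fun_sum _ fun s hs => ?_
  have hs := Finset.mem_range.1 hs
  refine Measurable.ite (MeasurableSet.inter (harm s hs (measurableSet_singleton a)) ?_) ?_
    measurable_const
  · exact measurableSet_lt (measurable_count rew (fun r hr => harm r (hr.trans hs)) a)
      measurable_const
  · exact ((measurable_pi_apply j).comp (hrew s hs)).sub_const _

lemma measurable_arm_historySigma (arm : ℕ → Ω → Fin A) (rew : ℕ → Ω → Fin D → ℝ) {s t : ℕ}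
    (hst : s < t) : Measurable[historySigma arm rew t] (arm s) :=
  have h : Measurable fun x : Fin t → Fin A × (Fin D → ℝ) => (x ⟨s, hst⟩).1 := by fun_prop
  h.comp (comap_measurable fun (ω : Ω) (s : Fin t) => (arm s ω, rew s ω))

lemma measurable_rew_historySigma (arm : ℕ → Ω → Fin A) (rew : ℕ → Ω → Fin D → ℝ) {s t : ℕ}
    (hst : s < t) : Measurable[historySigma arm rew t] (rew s) :=
  have h : Measurable fun x : Fin t → Fin A × (Fin D → ℝ) => (x ⟨s, hst⟩).2 := by fun_prop
  h.comp (comap_measurable fun (ω : Ω) (s : Fin t) => (arm s ω, rew s ω))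

namespace IsNomLexRun

variable [mΩ : MeasurableSpace Ω] {env : BanditEnv A D} {η : Fin D → ℝ} {P : Measure Ω}
  {arm : ℕ → Ω → Fin A} {rew : ℕ → Ω → Fin D → ℝ}

lemma historySigma_le (hrun : IsNomLexRun env η P arm rew) (t : ℕ) :
    historySigma arm rew t ≤ mΩ :=
  Measurable.comap_le (measurable_pi_lambda _ fun s =>
    (hrun.measurable_arm s).prodMk (hrun.measurable_rew s))

lemma measurableSet_arm (hrun : IsNomLexRun env η P arm rew) (t : ℕ) (k : Fin A) :
    MeasurableSet {ω | arm t ω = k} :=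
  hrun.measurable_arm t (measurableSet_singleton k)

lemma map_noise (hrun : IsNomLexRun env η P arm rew) (t : ℕ) (k : Fin A) {H : Set Ω}
    (hH : MeasurableSet[historySigma arm rew t] H) :
    (P.restrict (H ∩ {ω | arm t ω = k})).map (fun ω => rew t ω - env.mean k) =
      P (H ∩ {ω | arm t ω = k}) • env.noise k := by
  have hm : Measurable fun ω => rew t ω - env.mean k := (hrun.measurable_rew t).sub_const _
  ext B hB
  rw [Measure.map_apply hm hB, Measure.restrict_apply (hm hB), Measure.smul_apply, smul_eq_mul,
    ← hrun.noise_law t k H B hH hB, Set.inter_comm]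
  rfl

/-- Given the arm played, the noise is independent of the history. -/
lemma setLIntegral_mul_noise (hrun : IsNomLexRun env η P arm rew) (t : ℕ) (k : Fin A)
    {Z : Ω → ℝ≥0∞} (hZ : Measurable[historySigma arm rew t] Z) {f : (Fin D → ℝ) → ℝ≥0∞}
    (hf : Measurable f) :
    ∫⁻ ω in {ω | arm t ω = k}, Z ω * f (rew t ω - env.mean k) ∂P =
      (∫⁻ ω in {ω | arm t ω = k}, Z ω ∂P) * ∫⁻ x, f x ∂(env.noise k) := by
  have hle := hrun.historySigma_le t
  have hm : Measurable fun ω => rew t ω - env.mean k := (hrun.measurable_rew t).sub_const _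
  have hfm : Measurable fun ω => f (rew t ω - env.mean k) := hf.comp hm
  -- Monotone class argument in `Z`: indicators of history events are the case covered by
  -- `map_noise`.
  revert Z
  apply @Measurable.ennreal_induction _ (historySigma arm rew t)
  · intro c H hH
    have hH' := hle _ hH
    have h1 : ∀ ω, H.indicator (fun _ => c) ω * f (rew t ω - env.mean k) =
        H.indicator (fun ω => c * f (rew t ω - env.mean k)) ω := by
      intro ω
      by_cases hω : ω ∈ H <;> simp [hω]
    simp_rw [h1]
    rw [lintegral_indicator hH', lintegral_indicator hH', Measure.restrict_restrict hH',
      lintegral_const_mul _ hfm, ← lintegral_map hf hm, hrun.map_noise t k hH, lintegral_smul_measure,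
      lintegral_const, Measure.restrict_apply_univ, smul_eq_mul, mul_assoc]
  · intro f₁ f₂ _ h₁ _ ih₁ ih₂
    simp only [Pi.add_apply, add_mul]
    have h₁' := h₁.mono hle le_rfl
    rw [lintegral_add_left (f := fun ω => f₁ ω * f (rew t ω - env.mean k)) (h₁'.mul hfm), ih₁, ih₂,
      lintegral_add_left h₁', add_mul]
  · intro F hF hmono ih
    have hF' := fun n => (hF n).mono hle le_rfl
    simp only [ENNReal.iSup_mul]
    rw [lintegral_iSup (f := fun n ω => F n ω * f (rew t ω - env.mean k))
      (fun n => (hF' n).mul hfm) (fun m n hmn ω => mul_le_mul_left (hmono hmn ω) _),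
      lintegral_iSup hF' hmono, ENNReal.iSup_mul]
    simp_rw [ih]

/-- The integrand is a supermartingale in `t`. The second term of the exponent reserves `l ^ 2 / 2`
for each of the `n` noises not yet seen, and each new noise costs at most that much. At `t = 0` the
whole reserve is present, which gives the right-hand side. -/
lemma lintegral_exp_stoppedNoise_le (hrun : IsNomLexRun env η P arm rew) [IsProbabilityMeasure P]
    (a : Fin A) (j : Fin D) (n : ℕ) (l : ℝ) (t : ℕ) :
    ∫⁻ ω, ENNReal.ofReal (Real.exp (l * stoppedNoise env (playHistory arm rew ω) a j n t +
      l ^ 2 / 2 * (n - min (NomLex.count (playHistory arm rew ω) t a) n : ℕ))) ∂P ≤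
      ENNReal.ofReal (Real.exp (n * l ^ 2 / 2)) := by
  induction t with
  | zero =>
    simp only [stoppedNoise, NomLex.count_zero, Finset.range_zero, Finset.sum_empty, lintegral_const,
      measure_univ, mul_one]
    simp
    apply le_of_eq; ring_nf
  | succ t ih =>
    refine le_trans ?_ ih
    set Z : ℕ → Ω → ℝ≥0∞ := fun t ω => ENNReal.ofReal (Real.exp (l * stoppedNoise env
      (playHistory arm rew ω) a j n t +
      l ^ 2 / 2 * (n - min (NomLex.count (playHistory arm rew ω) t a) n : ℕ))) with hZ
    change ∫⁻ ω, Z (t + 1) ω ∂P ≤ ∫⁻ ω, Z t ω ∂P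
    have hle := hrun.historySigma_le t
    have hcount : Measurable[historySigma arm rew t]
        fun ω => NomLex.count (playHistory arm rew ω) t a :=
      measurable_count rew (fun s hs => measurable_arm_historySigma arm rew hs) a
    have hW : Measurable[historySigma arm rew t]
        fun ω => stoppedNoise env (playHistory arm rew ω) a j n t :=
      measurable_stoppedNoise env (fun s hs => measurable_arm_historySigma arm rew hs)
        (fun s hs => measurable_rew_historySigma arm rew hs) a j n
    have hZm : Measurable[historySigma arm rew t] (Z t) := by
      refine ENNReal.measurable_ofReal.comp (Real.measurable_exp.comp
        ((hW.const_mul l).add (Measurable.const_mul ?_ _)))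
      exact (measurable_from_nat (f := fun k : ℕ => ((n - min k n : ℕ) : ℝ))).comp hcount
    set H : Set Ω := {ω | NomLex.count (playHistory arm rew ω) t a < n}
    have hH : MeasurableSet[historySigma arm rew t] H := hcount (measurableSet_Iio (a := n))
    have hH' := hle _ hH
    set S : Set Ω := {ω | arm t ω = a}
    have hS : MeasurableSet S := hrun.measurableSet_arm t a
    set f : (Fin D → ℝ) → ℝ≥0∞ := fun x => ENNReal.ofReal (Real.exp (l * x j - l ^ 2 / 2))
    have hf : Measurable f := by fun_prop
    have hfint : ∫⁻ x, f x ∂(env.noise a) ≤ 1 := by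
      have h1 : ∀ x, f x = ENNReal.ofReal (Real.exp (-(l ^ 2 / 2))) *
          ENNReal.ofReal (Real.exp (l * x j)) := by
        intro x
        rw [← ENNReal.ofReal_mul (Real.exp_pos _).le, ← Real.exp_add]
        simp only [f]; ring_nf
      simp_rw [h1]
      rw [lintegral_const_mul _ (by fun_prop), ← ofReal_integral_eq_lintegral_ofReal
        ((env.noise_subG a j).integrable_exp_mul l) (by filter_upwards with x; positivity),
        ← ENNReal.ofReal_mul (Real.exp_pos _).le, ← ENNReal.ofReal_one]
      apply ENNReal.ofReal_le_ofReal
      have h2 := (env.noise_subG a j).mgf_le l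
      rw [mgf] at h2
      calc _ ≤ Real.exp (-(l ^ 2 / 2)) * Real.exp (((1 : NNReal) : ℝ) * l ^ 2 / 2) := by gcongr
        _ = 1 := by rw [← Real.exp_add]; simp
    have hB : MeasurableSet (H ∩ S) := hH'.inter hS
    -- On `H ∩ S` round `t` adds a noise to the sum, and the integral is multiplied by a factor at
    -- most one; off it neither the sum nor the reserve changes.
    rw [← lintegral_add_compl (Z (t + 1)) hB, ← lintegral_add_compl (Z t) hB]
    refine add_le_add ?_ (le_of_eq ?_)
    · calc ∫⁻ ω in H ∩ S, Z (t + 1) ω ∂P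
          = ∫⁻ ω in H ∩ S, Z t ω * f (rew t ω - env.mean a) ∂P := by
            refine setLIntegral_congr_fun hB fun ω hω => ?_
            have h1 : NomLex.count (playHistory arm rew ω) t a < n := hω.1
            have h2 : arm t ω = a := hω.2
            simp only [hZ, f]
            rw [← ENNReal.ofReal_mul (Real.exp_pos _).le, ← Real.exp_add, stoppedNoise_succ,
              NomLex.count_succ, if_pos ⟨h2, h1⟩,
              if_pos (show (playHistory arm rew ω t).1 = a from h2), min_eq_left h1.le,
              min_eq_left (by omega), Nat.cast_sub h1, Nat.cast_sub h1.le]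
            congr 2
            simp only [playHistory, Pi.sub_apply]
            push_cast; ring
        _ = ∫⁻ ω in S, H.indicator (Z t) ω * f (rew t ω - env.mean a) ∂P := by
            rw [← Measure.restrict_restrict hH', ← lintegral_indicator hH']
            congr 1; ext ω
            by_cases hω : ω ∈ H <;> simp [hω]
        _ = (∫⁻ ω in S, H.indicator (Z t) ω ∂P) * ∫⁻ x, f x ∂(env.noise a) :=
            hrun.setLIntegral_mul_noise t a (hZm.indicator hH) hf
        _ ≤ (∫⁻ ω in S, H.indicator (Z t) ω ∂P) * 1 := by gcongr
        _ = ∫⁻ ω in H ∩ S, Z t ω ∂P := by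
            rw [mul_one, lintegral_indicator hH', Measure.restrict_restrict hH']
    · refine setLIntegral_congr_fun hB.compl fun ω hω => ?_
      simp only [hZ]
      rw [stoppedNoise_succ, NomLex.count_succ]
      by_cases h2 : arm t ω = a
      · have h1 : ¬ NomLex.count (playHistory arm rew ω) t a < n := fun h1 => hω ⟨h1, h2⟩
        rw [if_neg (fun h => h1 h.2), min_eq_right (by omega), min_eq_right (by omega), add_zero]
      · have h3 : ¬ (playHistory arm rew ω t).1 = a := h2
        rw [if_neg (fun h => h3 h.1), if_neg h3, add_zero, add_zero]

/-- The stopped noise sum is sub-Gaussian with the same parameter as a sum of `n` independent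
noise terms. -/
lemma hasSubgaussianMGF_stoppedNoise (hrun : IsNomLexRun env η P arm rew) [IsProbabilityMeasure P]
    (a : Fin A) (j : Fin D) (n t : ℕ) :
    HasSubgaussianMGF (fun ω => stoppedNoise env (playHistory arm rew ω) a j n t) n P := by
  have hW : Measurable fun ω => stoppedNoise env (playHistory arm rew ω) a j n t :=
    measurable_stoppedNoise env (fun s _ => hrun.measurable_arm s)
      (fun s _ => hrun.measurable_rew s) a j n
  have hbound : ∀ l : ℝ, ∫⁻ ω, ENNReal.ofReal (Real.exp (l * stoppedNoise env
      (playHistory arm rew ω) a j n t)) ∂P ≤ ENNReal.ofReal (Real.exp (n * l ^ 2 / 2)) := by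
    intro l
    refine le_trans (lintegral_mono fun ω => ?_) (hrun.lintegral_exp_stoppedNoise_le a j n l t)
    -- The remaining reserve is nonnegative and can be dropped.
    exact ENNReal.ofReal_le_ofReal (Real.exp_le_exp.2 (le_add_of_nonneg_right (by positivity)))
  have hint : ∀ l : ℝ, Integrable (fun ω => Real.exp (l * stoppedNoise env
      (playHistory arm rew ω) a j n t)) P := by
    intro l
    refine ⟨(by fun_prop : Measurable _).aestronglyMeasurable, ?_⟩
    rw [hasFiniteIntegral_iff_ofReal (by filter_upwards with ω; positivity)]
    exact (hbound l).trans_lt ENNReal.ofReal_lt_top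
  refine ⟨hint, fun l => ?_⟩
  have h1 := hbound l
  rw [← ofReal_integral_eq_lintegral_ofReal (hint l) (by filter_upwards with x; positivity)] at h1
  exact_mod_cast (ENNReal.ofReal_le_ofReal_iff (Real.exp_pos _).le).1 h1

/-- Needed only for the improved tail bound at `n = 2`. -/
lemma integral_stoppedNoise (hrun : IsNomLexRun env η P arm rew) [IsProbabilityMeasure P]
    (a : Fin A) (j : Fin D) (n t : ℕ) :
    ∫ ω, stoppedNoise env (playHistory arm rew ω) a j n t ∂P = 0 := by
  induction t with
  | zero => simp [stoppedNoise]
  | succ t ih =>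
    have hm : Measurable fun ω => rew t ω - env.mean a := (hrun.measurable_rew t).sub_const _
    have hI := fun t => (hrun.hasSubgaussianMGF_stoppedNoise a j n t).integrable
    have hH : MeasurableSet[historySigma arm rew t]
        {ω | NomLex.count (playHistory arm rew ω) t a < n} :=
      (measurable_count rew (fun s hs => measurable_arm_historySigma arm rew hs) a)
        (measurableSet_Iio (a := n))
    have hB := (hrun.historySigma_le t _ hH).inter (hrun.measurableSet_arm t a)
    have h1 : ∫ ω, (stoppedNoise env (playHistory arm rew ω) a j n (t + 1) -
        stoppedNoise env (playHistory arm rew ω) a j n t) ∂P = 0 := by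
      calc _ = ∫ ω, ({ω | NomLex.count (playHistory arm rew ω) t a < n} ∩
            {ω | arm t ω = a}).indicator (fun ω => (rew t ω - env.mean a) j) ω ∂P := by
            congr 1; ext ω
            rw [stoppedNoise_succ, add_sub_cancel_left]
            by_cases hω : arm t ω = a ∧ NomLex.count (playHistory arm rew ω) t a < n
            · rw [Set.indicator_of_mem (show ω ∈ _ ∩ _ from ⟨hω.2, hω.1⟩)]
              exact if_pos hω
            · have hω' : ω ∉ {ω | NomLex.count (playHistory arm rew ω) t a < n} ∩
                  {ω | arm t ω = a} := fun h => hω ⟨h.2, h.1⟩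
              rw [Set.indicator_of_notMem hω']
              exact if_neg hω
        _ = ∫ x, x j ∂((P.restrict ({ω | NomLex.count (playHistory arm rew ω) t a < n} ∩
            {ω | arm t ω = a})).map (fun ω => rew t ω - env.mean a)) := by
            rw [integral_indicator hB, integral_map hm.aemeasurable
              (measurable_pi_apply j).aestronglyMeasurable]
        _ = 0 := by
            rw [hrun.map_noise t a hH, integral_smul_measure, env.noise_mean, smul_zero]
    rw [integral_sub (hI _) (hI _), ih, sub_zero] at h1
    exact h1

end IsNomLexRun

end Noise

/-! ### Pathwise bound on the number of plays. -/

section Play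

variable {A D : ℕ}

/-- The arm played in round `t` has positive probability given the previous rounds. -/
def NomLex.IsConsistentAt (η : Fin D → ℝ) (h : ℕ → Fin A × (Fin D → ℝ)) (t : ℕ) (k : Fin A) :
    Prop :=
  (0 < NomLex.sweepLeft η h t ∧ (k : ℕ) = A - NomLex.sweepLeft η h t) ∨
  (NomLex.sweepLeft η h t = 0 ∧ k ∈ NomLex.candidates η h t) ∨
  (NomLex.sweepLeft η h t = 0 ∧ (∀ b, b ∉ NomLex.candidates η h t) ∧ (k : ℕ) = 0)

lemma NomLex.playProb_eq_zero {η : Fin D → ℝ} {h : ℕ → Fin A × (Fin D → ℝ)} {t : ℕ} {k : Fin A}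
    (hk : ¬ NomLex.IsConsistentAt η h t k) : NomLex.playProb η h t k = 0 := by
  simp only [NomLex.IsConsistentAt, not_or, not_and] at hk
  obtain ⟨h1, h2, h3⟩ := hk
  unfold NomLex.playProb
  by_cases hs : 0 < NomLex.sweepLeft η h t
  · rw [if_pos hs, if_neg (h1 hs)]
  · have hs0 : NomLex.sweepLeft η h t = 0 := by omega
    rw [if_neg hs]
    by_cases hc : (NomLex.candidates η h t).Nonempty
    · rw [if_pos hc, if_neg (h2 hs0)]
    · rw [if_neg hc, if_neg (h3 hs0 fun b hb => hc ⟨b, hb⟩)]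

namespace NomLex

variable (η : Fin D → ℝ) (h : ℕ → Fin A × (Fin D → ℝ))

open Classical in
/-- The rounds before `t` that start a new sweep (other than the initial one). -/
noncomputable def sweepStarts (t : ℕ) : Finset ℕ :=
  {s ∈ Finset.range t | sweepLeft η h s = 0 ∧ ¬ (candidates η h s).Nonempty}

open Classical in
/-- The rounds before `t` outside sweeps in which `a` is played. -/
noncomputable def freePlays (a : Fin A) (t : ℕ) : Finset ℕ :=
  {s ∈ Finset.range t | (sweepLeft η h s = 0 ∧ (candidates η h s).Nonempty) ∧ (h s).1 = a}

open Classical in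
/-- The number of plays of `a` in sweeps before round `t`. -/
noncomputable def sweepPlays (a : Fin A) (t : ℕ) : ℕ :=
  ∑ s ∈ Finset.range t,
    if ¬ (sweepLeft η h s = 0 ∧ (candidates η h s).Nonempty) ∧ (h s).1 = a then 1 else 0

variable {η h}

lemma sweepLeft_le (t : ℕ) : sweepLeft η h t ≤ A := by
  induction t with
  | zero => simp [sweepLeft]
  | succ t ih => rw [sweepLeft]; split_ifs <;> omega

lemma count_eq_sweepPlays_add (a : Fin A) (t : ℕ) :
    count h t a = sweepPlays η h a t + (freePlays η h a t).card := by
  classical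
  rw [count_eq_sum, freePlays, Finset.card_filter, sweepPlays, ← Finset.sum_add_distrib]
  refine Finset.sum_congr rfl fun s _ => ?_
  by_cases h1 : sweepLeft η h s = 0 ∧ (candidates η h s).Nonempty <;> simp [h1]

lemma sweepStarts_card_succ (t : ℕ) [Decidable (candidates η h t).Nonempty] :
    (sweepStarts η h (t + 1)).card = (sweepStarts η h t).card +
      if sweepLeft η h t = 0 ∧ ¬ (candidates η h t).Nonempty then 1 else 0 := by
  classical
  rw [sweepStarts, sweepStarts, Finset.card_filter, Finset.card_filter, Finset.sum_range_succ]
  congr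

lemma sweepPlays_succ (a : Fin A) (t : ℕ) [Decidable (candidates η h t).Nonempty] :
    sweepPlays η h a (t + 1) = sweepPlays η h a t +
      if ¬ (sweepLeft η h t = 0 ∧ (candidates η h t).Nonempty) ∧ (h t).1 = a then 1 else 0 := by
  classical
  rw [sweepPlays, sweepPlays, Finset.sum_range_succ]
  congr

/-- Every sweep plays each arm once. The indicator says that the current sweep has already reached
`a`; it also makes up for the initial sweep, which `sweepStarts` omits. -/
lemma sweepPlays_eq (hcons : ∀ t, IsConsistentAt η h t (h t).1) (a : Fin A) (t : ℕ) :
    sweepPlays η h a t = (sweepStarts η h t).card +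
      if (a : ℕ) < A - sweepLeft η h t then 1 else 0 := by
  classical
  induction t with
  | zero => simp [sweepPlays, sweepStarts, sweepLeft]
  | succ t ih =>
    have hA := a.isLt
    have hle := sweepLeft_le (η := η) (h := h) t
    have heq : (h t).1 = a ↔ ((h t).1 : ℕ) = a := Fin.ext_iff
    rw [sweepPlays_succ, sweepStarts_card_succ, ih, sweepLeft]
    rcases hcons t with ⟨h1, h2⟩ | ⟨h1, h2⟩ | ⟨h1, h2, h3⟩
    · simp only [h1, h1.ne', heq, h2, false_and, not_false_eq_true, true_and, if_true, if_false]
      split_ifs <;> omega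
    · have hne : (candidates η h t).Nonempty := ⟨_, h2⟩
      simp [h1, hne]
    · have hne : ¬ (candidates η h t).Nonempty := fun ⟨b, hb⟩ => h2 b hb
      simp only [h1, hne, heq, h3, and_false, not_false_eq_true, true_and, and_self, if_true,
        if_false, lt_irrefl]
      split_ifs <;> omega

lemma sweepPlays_of_sweepLeft_eq_zero (hcons : ∀ t, IsConsistentAt η h t (h t).1) (a : Fin A)
    {t : ℕ} (ht : sweepLeft η h t = 0) :
    sweepPlays η h a t = (sweepStarts η h t).card + 1 := by
  have := a.isLt
  rw [sweepPlays_eq hcons, ht, if_pos (by omega)]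

lemma sweepStarts_mono {s t : ℕ} (hst : s ≤ t) : sweepStarts η h s ⊆ sweepStarts η h t := by
  classical
  intro r hr
  simp only [sweepStarts, Finset.mem_filter, Finset.mem_range] at hr ⊢
  exact ⟨hr.1.trans_le hst, hr.2⟩

lemma freePlays_mono (a : Fin A) {s t : ℕ} (hst : s ≤ t) :
    freePlays η h a s ⊆ freePlays η h a t := by
  classical
  intro r hr
  simp only [freePlays, Finset.mem_filter, Finset.mem_range] at hr ⊢
  exact ⟨hr.1.trans_le hst, hr.2⟩

lemma count_mono (a : Fin A) : Monotone fun t => count h t a := by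
  refine monotone_nat_of_le_succ fun t => ?_
  rw [count_succ]; omega

lemma count_le (a : Fin A) (t : ℕ) : count h t a ≤ t :=
  (Finset.card_filter_le _ _).trans (Finset.card_range t).le

-- The count of `b` separates sweep starts, because the sweep begun at the earlier one plays `b`
-- before the later one. It is at least one because the initial sweep is over.
open Classical in
lemma card_sweepStarts_le (hcons : ∀ t, IsConsistentAt η h t (h t).1) (b : Fin A) (T : ℕ) :
    (sweepStarts η h T).card ≤ (Finset.filter
      (fun n => ∃ t < T, count h t b = n ∧ b ∉ candidates η h t) (Finset.Icc 1 T)).card := by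
  have hmem : ∀ t ∈ sweepStarts η h T, t < T ∧ sweepLeft η h t = 0 ∧
      ¬ (candidates η h t).Nonempty := by
    intro t ht
    simpa [sweepStarts] using ht
  refine Finset.card_le_card_of_injOn (fun t => count h t b) ?_ ?_
  · intro t ht
    obtain ⟨h1, h2, h3⟩ := hmem t ht
    have h4 := count_eq_sweepPlays_add (η := η) (h := h) b t
    rw [sweepPlays_of_sweepLeft_eq_zero hcons b h2] at h4
    have h5 := count_le (h := h) b t
    simp only [Finset.coe_filter, Finset.mem_Icc]
    exact ⟨⟨by omega, by omega⟩, t, h1, rfl, fun hb => h3 ⟨b, hb⟩⟩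
  · have key : ∀ s ∈ sweepStarts η h T, ∀ t ∈ sweepStarts η h T, s < t →
        count h s b < count h t b := by
      intro s hs t ht hst
      obtain ⟨_, hs2, hs3⟩ := hmem s hs
      obtain ⟨_, ht2, _⟩ := hmem t ht
      have h1 : (sweepStarts η h (s + 1)).card = (sweepStarts η h s).card + 1 := by
        rw [sweepStarts_card_succ, if_pos ⟨hs2, hs3⟩]
      have h2 := Finset.card_le_card (sweepStarts_mono (η := η) (h := h) (Nat.succ_le_of_lt hst))
      have h3 := Finset.card_le_card (freePlays_mono (η := η) (h := h) b hst.le)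
      rw [count_eq_sweepPlays_add (η := η), count_eq_sweepPlays_add (η := η),
        sweepPlays_of_sweepLeft_eq_zero hcons b hs2, sweepPlays_of_sweepLeft_eq_zero hcons b ht2]
      rw [Nat.succ_eq_add_one] at h2
      omega
    intro s hs t ht hst
    by_contra hne
    rcases lt_or_gt_of_ne hne with hlt | hlt
    · exact (key s hs t ht hlt).ne hst
    · exact (key t ht s hs hlt).ne hst.symm

-- The count of `a` separates free plays, because each of them raises it.
open Classical in
lemma card_freePlays_le (hcons : ∀ t, IsConsistentAt η h t (h t).1) (a : Fin A) (T : ℕ) :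
    (freePlays η h a T).card ≤ (Finset.filter
      (fun n => ∃ t < T, count h t a = n ∧ a ∈ candidates η h t) (Finset.Icc 1 T)).card := by
  have hmem : ∀ t ∈ freePlays η h a T, t < T ∧ (sweepLeft η h t = 0 ∧
      (candidates η h t).Nonempty) ∧ (h t).1 = a := by
    intro t ht
    simpa [freePlays] using ht
  refine Finset.card_le_card_of_injOn (fun t => count h t a) ?_ ?_
  · intro t ht
    obtain ⟨h1, ⟨h2, h3⟩, h4⟩ := hmem t ht
    have h5 := count_eq_sweepPlays_add (η := η) (h := h) a t
    rw [sweepPlays_of_sweepLeft_eq_zero hcons a h2] at h5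
    have h6 := count_le (h := h) a t
    simp only [Finset.coe_filter, Finset.mem_Icc]
    refine ⟨⟨by omega, by omega⟩, t, h1, rfl, ?_⟩
    rcases hcons t with ⟨h7, _⟩ | ⟨_, h8⟩ | ⟨_, h8, _⟩
    · omega
    · rwa [h4] at h8
    · exact absurd h3 fun ⟨b, hb⟩ => h8 b hb
  · have key : ∀ s ∈ freePlays η h a T, ∀ t, s < t → count h s a < count h t a := by
      intro s hs t hst
      have h1 : count h (s + 1) a = count h s a + 1 := by
        rw [count_succ, if_pos (hmem s hs).2.2]
      have h2 := count_mono (h := h) a (Nat.succ_le_of_lt hst)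
      simp only [Nat.succ_eq_add_one] at h2
      omega
    intro s hs t ht hst
    by_contra hne
    rcases lt_or_gt_of_ne hne with hlt | hlt
    · exact (key s hs t hlt).ne hst
    · exact (key t ht s hlt).ne hst.symm

open Classical in
/-- The number of plays of `a`, in terms of the play counts at which `b` fails to be a candidate
and those at which `a` is a candidate. -/
lemma count_le_card_add_card (hcons : ∀ t, IsConsistentAt η h t (h t).1) (a b : Fin A) (T : ℕ) :
    count h T a ≤ 1 +
      (Finset.filter (fun n => ∃ t < T, count h t b = n ∧ b ∉ candidates η h t)
        (Finset.Icc 1 T)).card +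
      (Finset.filter (fun n => ∃ t < T, count h t a = n ∧ a ∈ candidates η h t)
        (Finset.Icc 1 T)).card := by
  have h1 := count_eq_sweepPlays_add (η := η) (h := h) a T
  have h2 := sweepPlays_eq hcons a T
  have h3 := card_sweepStarts_le hcons b T
  have h4 := card_freePlays_le hcons a T
  have h5 : (if (a : ℕ) < A - sweepLeft η h T then 1 else 0) ≤ 1 := by split_ifs <;> omega
  omega

/-- As long as arm `a` has been played at most `n` times, the stopped noise is the sum of the
centred rewards of `a`. -/
lemma stoppedNoise_eq (env : BanditEnv A D) (a : Fin A) (j : Fin D) {n t : ℕ}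
    (hn : count h t a ≤ n) :
    stoppedNoise env h a j n t =
      ∑ s ∈ (Finset.range t).filter (fun s => (h s).1 = a), ((h s).2 j - env.mean a j) := by
  rw [stoppedNoise, Finset.sum_filter]
  refine Finset.sum_congr rfl fun s hs => ?_
  by_cases h1 : (h s).1 = a
  · have h2 := count_mono (h := h) a (Nat.succ_le_of_lt (Finset.mem_range.1 hs))
    simp only [Nat.succ_eq_add_one, count_succ, if_pos h1] at h2
    rw [if_pos ⟨h1, by omega⟩, if_pos h1]
  · rw [if_neg (fun h => h1 h.1), if_neg h1]

/-- The stopped sum is frozen once `a` has `n` plays, so it may be read off at the final time `T`.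
An event at an unknown round `t` thus becomes one event at `T`, with no union bound over rounds. -/
lemma stoppedNoise_of_count_eq (env : BanditEnv A D) (a : Fin A) (j : Fin D) {n t T : ℕ}
    (hn : count h t a = n) (htT : t ≤ T) (hn0 : 0 < n) :
    stoppedNoise env h a j n T = n * (empMean h t a j - env.mean a j) := by
  have h1 : stoppedNoise env h a j n T = stoppedNoise env h a j n t := by
    induction T, htT using Nat.le_induction with
    | base => rfl
    | succ T hT ih =>
      have h2 := count_mono (h := h) a hT
      simp only at h2
      rw [stoppedNoise_succ, ih, if_neg (fun h => by omega), add_zero]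
  have hn' : (n : ℝ) ≠ 0 := by exact_mod_cast hn0.ne'
  rw [h1, stoppedNoise_eq env a j hn.le, Finset.sum_sub_distrib, Finset.sum_const, empMean, hn,
    mul_sub, mul_div_cancel₀ _ hn', nsmul_eq_mul]
  congr 2
  exact_mod_cast hn

end NomLex

end Play

/-! ### Almost every run follows the rules of the algorithm. -/

section Consistent

variable {A D : ℕ} {Ω : Type*}

lemma measurable_empMean {m : MeasurableSpace Ω} {arm : ℕ → Ω → Fin A}
    {rew : ℕ → Ω → Fin D → ℝ} {t : ℕ} (harm : ∀ s < t, Measurable (arm s))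
    (hrew : ∀ s < t, Measurable (rew s)) (a : Fin A) (j : Fin D) :
    Measurable fun ω => NomLex.empMean (playHistory arm rew ω) t a j := by
  simp only [NomLex.empMean, Finset.sum_filter]
  refine Measurable.div ?_ (measurable_from_nat.comp (measurable_count rew harm a))
  refine Finset.measurable_fun_sum _ fun s hs => ?_
  have hs := Finset.mem_range.1 hs
  exact Measurable.ite (harm s hs (measurableSet_singleton a))
    ((measurable_pi_apply j).comp (hrew s hs)) measurable_const

lemma measurableSet_mem_candidates {m : MeasurableSpace Ω} {arm : ℕ → Ω → Fin A}
    {rew : ℕ → Ω → Fin D → ℝ} {t : ℕ} (harm : ∀ s < t, Measurable (arm s))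
    (hrew : ∀ s < t, Measurable (rew s)) (η : Fin D → ℝ) (a : Fin A) :
    MeasurableSet {ω | a ∈ NomLex.candidates η (playHistory arm rew ω) t} := by
  simp only [NomLex.candidates, Finset.mem_filter, Finset.mem_univ, true_and]
  have h1 : {ω | ∀ i, NomLex.empMean (playHistory arm rew ω) t a i - η i >
      -Real.sqrt (4 * Real.log (NomLex.count (playHistory arm rew ω) t a : ℝ) /
        (NomLex.count (playHistory arm rew ω) t a : ℝ))} =
      ⋂ i, {ω | -Real.sqrt (4 * Real.log (NomLex.count (playHistory arm rew ω) t a : ℝ) /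
        (NomLex.count (playHistory arm rew ω) t a : ℝ)) <
        NomLex.empMean (playHistory arm rew ω) t a i - η i} := by
    ext ω; simp
  rw [h1]
  refine MeasurableSet.iInter fun i => measurableSet_lt ?_
    ((measurable_empMean harm hrew a i).sub_const _)
  exact (measurable_from_nat (f := fun k : ℕ => -Real.sqrt (4 * Real.log (k : ℝ) / (k : ℝ)))).comp
    (measurable_count rew harm a)

lemma measurableSet_candidates_nonempty {m : MeasurableSpace Ω} {arm : ℕ → Ω → Fin A}
    {rew : ℕ → Ω → Fin D → ℝ} {t : ℕ} (harm : ∀ s < t, Measurable (arm s))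
    (hrew : ∀ s < t, Measurable (rew s)) (η : Fin D → ℝ) :
    MeasurableSet {ω | (NomLex.candidates η (playHistory arm rew ω) t).Nonempty} := by
  have h1 : {ω | (NomLex.candidates η (playHistory arm rew ω) t).Nonempty} =
      ⋃ a, {ω | a ∈ NomLex.candidates η (playHistory arm rew ω) t} := by
    ext ω; simp [Finset.Nonempty]
  rw [h1]
  exact MeasurableSet.iUnion fun a => measurableSet_mem_candidates harm hrew η a

lemma measurable_sweepLeft {m : MeasurableSpace Ω} {arm : ℕ → Ω → Fin A}
    {rew : ℕ → Ω → Fin D → ℝ} {t : ℕ} (harm : ∀ s < t, Measurable (arm s))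
    (hrew : ∀ s < t, Measurable (rew s)) (η : Fin D → ℝ) :
    Measurable fun ω => NomLex.sweepLeft η (playHistory arm rew ω) t := by
  classical
  induction t with
  | zero => simp only [NomLex.sweepLeft]; exact measurable_const
  | succ t ih =>
    have harm' := fun s (hs : s < t) => harm s (hs.trans t.lt_succ_self)
    have hrew' := fun s (hs : s < t) => hrew s (hs.trans t.lt_succ_self)
    have ih := ih harm' hrew'
    simp only [NomLex.sweepLeft]
    refine Measurable.ite (ih (measurableSet_Ioi (a := 0))) 
      ((measurable_from_nat (f := fun l : ℕ => l - 1)).comp ih) ?_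
    exact Measurable.ite (measurableSet_candidates_nonempty harm' hrew' η) measurable_const
      measurable_const

lemma measurableSet_isConsistentAt {m : MeasurableSpace Ω} {arm : ℕ → Ω → Fin A}
    {rew : ℕ → Ω → Fin D → ℝ} {t : ℕ} (harm : ∀ s < t, Measurable (arm s))
    (hrew : ∀ s < t, Measurable (rew s)) (η : Fin D → ℝ) (k : Fin A) :
    MeasurableSet {ω | NomLex.IsConsistentAt η (playHistory arm rew ω) t k} := by
  have hs := measurable_sweepLeft harm hrew η
  have h0 : MeasurableSet {ω | NomLex.sweepLeft η (playHistory arm rew ω) t = 0} :=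
    hs (measurableSet_singleton 0)
  refine MeasurableSet.union ?_ (MeasurableSet.union ?_ ?_)
  · exact hs (t := {l | 0 < l ∧ (k : ℕ) = A - l}) (MeasurableSet.of_discrete)
  · exact h0.inter (measurableSet_mem_candidates harm hrew η k)
  · refine h0.inter (MeasurableSet.inter ?_ (MeasurableSet.const _))
    have h1 : {ω | ∀ b, b ∉ NomLex.candidates η (playHistory arm rew ω) t} =
        ⋂ b, {ω | b ∈ NomLex.candidates η (playHistory arm rew ω) t}ᶜ := by
      ext ω; simp
    refine (congrArg MeasurableSet h1).mpr ?_
    exact MeasurableSet.iInter fun b => (measurableSet_mem_candidates harm hrew η b).compl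

/-- An arm of conditional probability zero is almost surely not played. This is all that is used of
the arm law; uniformity among the candidates plays no role. -/
lemma IsNomLexRun.ae_isConsistentAt [MeasurableSpace Ω] {env : BanditEnv A D} {η : Fin D → ℝ}
    {P : Measure Ω} {arm : ℕ → Ω → Fin A} {rew : ℕ → Ω → Fin D → ℝ}
    (hrun : IsNomLexRun env η P arm rew) :
    ∀ᵐ ω ∂P, ∀ t, NomLex.IsConsistentAt η (playHistory arm rew ω) t (arm t ω) := by
  rw [ae_all_iff]
  intro t
  have h1 : ∀ᵐ ω ∂P, ∀ k, ¬ (ω ∈ {ω | NomLex.IsConsistentAt η (playHistory arm rew ω) t k}ᶜ ∩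
      {ω | arm t ω = k}) := by
    rw [ae_all_iff]
    intro k
    have hH : MeasurableSet[historySigma arm rew t]
        {ω | NomLex.IsConsistentAt η (playHistory arm rew ω) t k}ᶜ :=
      MeasurableSet.compl (measurableSet_isConsistentAt
        (fun s hs => measurable_arm_historySigma arm rew hs)
        (fun s hs => measurable_rew_historySigma arm rew hs) η k)
    refine measure_eq_zero_iff_ae_notMem.1 ?_
    rw [hrun.arm_law t k _ hH]
    refine (setLIntegral_congr_fun (g := fun _ => 0) (hrun.historySigma_le t _ hH)
      fun ω hω => NomLex.playProb_eq_zero hω).trans lintegral_zero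
  filter_upwards [h1] with ω hω
  by_contra hc
  exact hω (arm t ω) ⟨hc, rfl⟩

end Consistent

/-! ### Tail bounds and their sums over sample sizes. -/

section Tails

lemma lt_exp_five : (144 : ℝ) < Real.exp 5 := by
  have h1 : Real.exp 5 = Real.exp 1 ^ 5 := by rw [← Real.exp_nat_mul]; norm_num
  have h2 := Real.exp_one_gt_d9
  rw [h1]
  calc (144 : ℝ) < 2.718 ^ 5 := by norm_num
    _ ≤ Real.exp 1 ^ 5 := by gcongr; linarith

/-- A Chernoff-type bound that also uses that the mean vanishes. -/
lemma measureReal_three_mul_log_two_le {Ω : Type*} [MeasurableSpace Ω] {P : Measure Ω}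
    [IsProbabilityMeasure P] {Y : Ω → ℝ} (hYm : Measurable Y) (hY : Integrable Y P)
    (hY0 : ∫ ω, Y ω ∂P = 0) (hexp : Integrable (fun ω => Real.exp (Y ω)) P)
    (hV : ∫ ω, Real.exp (Y ω) ∂P ≤ Real.exp (9 / 8 * Real.log 2)) :
    P.real {ω | 3 * Real.log 2 ≤ Y ω} ≤ 0.22 := by
  have hl1 := Real.log_two_gt_d9
  have hl2 := Real.log_two_lt_d9
  -- The exponential lies above its tangent at `-log 2`, and on `S` its tangent at `3 * log 2` shows
  -- that it exceeds the first line by at least `g`. Taking expectations removes the linear term, as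
  -- `Y` is centred.
  set g : ℝ := 8 - (1 + 4 * Real.log 2) / 2 with hg
  set S : Set Ω := {ω | 3 * Real.log 2 ≤ Y ω}
  have hS : MeasurableSet S := measurableSet_le measurable_const hYm
  have hpt : ∀ ω, (1 + Real.log 2) / 2 + Y ω / 2 + S.indicator (fun _ => g) ω ≤
      Real.exp (Y ω) := by
    intro ω
    by_cases hω : ω ∈ S
    · have h1 : 3 * Real.log 2 ≤ Y ω := hω
      have h2 : Real.exp (Y ω) = 8 * Real.exp (Y ω - 3 * Real.log 2) := by
        have h3 : Real.exp (3 * Real.log 2) = 8 := by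
          rw [show (3 : ℝ) * Real.log 2 = ((3 : ℕ) : ℝ) * Real.log 2 by norm_num,
            Real.exp_nat_mul, Real.exp_log two_pos]
          norm_num
        rw [Real.exp_sub, h3]; ring
      have h4 := Real.add_one_le_exp (Y ω - 3 * Real.log 2)
      rw [Set.indicator_of_mem hω, h2]
      linarith
    · have h2 : Real.exp (Y ω) = Real.exp (Y ω + Real.log 2) / 2 := by
        rw [Real.exp_add, Real.exp_log two_pos]; ring
      have h4 := Real.add_one_le_exp (Y ω + Real.log 2)
      rw [Set.indicator_of_notMem hω, h2]
      linarith
  have hint1 : Integrable (fun ω => (1 + Real.log 2) / 2 + Y ω / 2) P :=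
    (integrable_const _).add (hY.div_const 2)
  have hint2 : Integrable (S.indicator fun _ => g) P := (integrable_const g).indicator hS
  have h5 := integral_mono (hint1.add hint2) hexp hpt
  simp only [Pi.add_apply] at h5
  rw [integral_add hint1 hint2, integral_add (integrable_const _) (hY.div_const 2),
    integral_div, integral_div, hY0, integral_indicator_const _ hS] at h5
  simp only [integral_const, probReal_univ, smul_eq_mul] at h5
  -- The quotient of `2.19 - (1 + log 2) / 2` by `g` is just below `0.22`.
  have h6 : Real.exp (9 / 8 * Real.log 2) ≤ 2.19 := by
    have h7 : Real.exp (9 / 8 * Real.log 2) ^ 8 = 512 := by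
      rw [← Real.exp_nat_mul,
        show ((8 : ℕ) : ℝ) * (9 / 8 * Real.log 2) = ((9 : ℕ) : ℝ) * Real.log 2 by push_cast; ring,
        Real.exp_nat_mul, Real.exp_log two_pos]
      norm_num
    refine le_of_pow_le_pow_left₀ (n := 8) (by norm_num) (by norm_num) ?_
    rw [h7]; norm_num
  by_contra hcon
  rw [not_le] at hcon
  have h8 : 0 < g := by rw [hg]; linarith
  have h9 : 0.22 * g ≤ P.real S * g := by gcongr
  rw [hg] at h9 h5
  linarith

/-- The bound on the probability that the sample mean of `n` rewards of a satisficing arm falls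
below the confidence bound. -/
noncomputable def lowerTailBound (n : ℕ) : ℝ := 1 / (n : ℝ) ^ 2 - if n = 2 then 0.03 else 0

lemma sum_lowerTailBound_le (T : ℕ) :
    ∑ n ∈ Finset.Icc 1 T, lowerTailBound n ≤ Real.pi ^ 2 / 6 - 0.03 := by
  by_cases hT : 2 ≤ T
  · have h1 := sum_le_hasSum (Finset.Icc 1 T) (fun n _ => by positivity) hasSum_zeta_two
    simp only [lowerTailBound, Finset.sum_sub_distrib, Finset.sum_ite_eq', Finset.mem_Icc,
      one_le_two, hT, and_self, if_true]
    linarith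
  · have h2 := Real.pi_gt_d2
    have h3 : (3.14 : ℝ) ^ 2 ≤ Real.pi ^ 2 := by gcongr
    have h4 : T = 0 ∨ T = 1 := by omega
    rcases h4 with rfl | rfl
    · simp; norm_num at h3 ⊢; linarith
    · simp [lowerTailBound]; norm_num at h3 ⊢; linarith

/-- The radius is chosen so that the Chernoff exponent is `2 * log n`. Only `n = 2` needs the
refined bound, `0.22` instead of `1 / 4`. -/
lemma measureReal_stoppedNoise_le_neg_le {A D : ℕ} {Ω : Type*} [MeasurableSpace Ω]
    {env : BanditEnv A D} {η : Fin D → ℝ}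
    {P : Measure Ω} [IsProbabilityMeasure P] {arm : ℕ → Ω → Fin A} {rew : ℕ → Ω → Fin D → ℝ}
    (hrun : IsNomLexRun env η P arm rew) (a : Fin A) (j : Fin D) (T : ℕ) {n : ℕ} (hn : 1 ≤ n) :
    P.real {ω | stoppedNoise env (playHistory arm rew ω) a j n T ≤
      -(n * Real.sqrt (4 * Real.log n / n))} ≤ lowerTailBound n := by
  have hsub := hrun.hasSubgaussianMGF_stoppedNoise a j n T
  have hn' : (1 : ℝ) ≤ n := by exact_mod_cast hn
  by_cases h2 : n = 2
  · subst h2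
    set W : Ω → ℝ := fun ω => stoppedNoise env (playHistory arm rew ω) a j 2 T
    have hl0 : 0 < Real.log 2 := Real.log_pos one_lt_two
    set r : ℝ := Real.sqrt (2 * Real.log 2)
    have hr : r * r = 2 * Real.log 2 := Real.mul_self_sqrt (by positivity)
    have hr0 : 0 < r := Real.sqrt_pos.2 (by positivity)
    -- The multiplier `3 / 4 * r` is below the Chernoff-optimal `r`. It puts the threshold at `3 *
    -- log 2` and bounds the exponential moment by `2 ^ (9 / 8)`.
    have hset : {ω | W ω ≤ -(((2 : ℕ) : ℝ) * Real.sqrt (4 * Real.log (2 : ℕ) / (2 : ℕ)))} ⊆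
        {ω | 3 * Real.log 2 ≤ -(3 / 4 * r) * W ω} := by
      intro ω hω
      have h1 : W ω ≤ -(((2 : ℕ) : ℝ) * Real.sqrt (4 * Real.log (2 : ℕ) / (2 : ℕ))) := hω
      have h3 : 4 * Real.log (2 : ℕ) / (2 : ℕ) = 2 * Real.log 2 := by push_cast; ring
      rw [h3] at h1
      push_cast at h1
      change 3 * Real.log 2 ≤ -(3 / 4 * r) * W ω
      nlinarith
    refine (measureReal_mono hset).trans ?_
    refine (measureReal_three_mul_log_two_le ?_ (hsub.integrable.const_mul _) ?_
      (hsub.integrable_exp_mul _) ?_).trans ?_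
    · exact (measurable_stoppedNoise env (fun s _ => hrun.measurable_arm s)
        (fun s _ => hrun.measurable_rew s) a j 2).const_mul _
    · rw [integral_const_mul, hrun.integral_stoppedNoise, mul_zero]
    · refine (hsub.mgf_le (-(3 / 4 * r))).trans (Real.exp_le_exp.2 (le_of_eq ?_))
      push_cast
      linear_combination (9 / 16 : ℝ) * hr
    · norm_num [lowerTailBound]
  · have h1 := hsub.neg.measure_ge_le (ε := n * Real.sqrt (4 * Real.log n / n)) (by positivity)
    have h3 : {ω | stoppedNoise env (playHistory arm rew ω) a j n T ≤
        -(n * Real.sqrt (4 * Real.log n / n))} = {ω | n * Real.sqrt (4 * Real.log n / n) ≤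
        (-fun ω => stoppedNoise env (playHistory arm rew ω) a j n T) ω} := by
      ext ω
      simp only [Set.mem_ofPred_eq, Pi.neg_apply]
      exact le_neg
    rw [h3]
    refine h1.trans (le_of_eq ?_)
    have hlog := Real.log_nonneg hn'
    rw [mul_pow, Real.sq_sqrt (by positivity), lowerTailBound, if_neg h2, sub_zero]
    have h4 : -((n : ℝ) ^ 2 * (4 * Real.log n / n)) / (2 * ((n : NNReal) : ℝ)) =
        -(((2 : ℕ) : ℝ) * Real.log n) := by
      push_cast; field_simp; ring
    rw [h4, Real.exp_neg, Real.exp_nat_mul, Real.exp_log (by linarith), one_div]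

/-- The number of plays above which the confidence radius is at most two thirds of the gap `M`. -/
noncomputable def playThreshold (M : ℝ) : ℝ := 12 * (Real.log (36 / M ^ 2) - 1) / M ^ 2

lemma sqrt_log_div_le {M : ℝ} (hM : 0 < M) {n : ℕ} (hn : 1 ≤ n) (hnM : playThreshold M ≤ n) :
    Real.sqrt (4 * Real.log n / n) ≤ 2 * M / 3 := by
  have hn' : (0 : ℝ) < n := by exact_mod_cast hn
  have hK : (0 : ℝ) < 36 / M ^ 2 := by positivity
  refine Real.sqrt_le_iff.2 ⟨by positivity, ?_⟩
  rw [div_le_iff₀ hn']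
  -- Tangent of the logarithm at `36 / M ^ 2`: the linear part of `4 * log n` is `n * M ^ 2 / 9`,
  -- and `playThreshold` makes the constant part at most `n * M ^ 2 / 3`. They add up to `n * (2 * M
  -- / 3) ^ 2`.
  have h1 := Real.log_le_sub_one_of_pos (div_pos hn' hK)
  rw [Real.log_div hn'.ne' hK.ne'] at h1
  have h2 : (n : ℝ) / (36 / M ^ 2) = n * M ^ 2 / 36 := by field_simp
  rw [h2] at h1
  rw [playThreshold, div_le_iff₀ (by positivity)] at hnM
  nlinarith

open Classical in
/-- The bound on the probability that the sample mean of `n` rewards of an arm with gap `M` is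
within the confidence bound of the threshold. -/
noncomputable def upperTailBound (M : ℝ) (n : ℕ) : ℝ :=
  if (n : ℝ) < playThreshold M then 1 else Real.exp (-(M ^ 2 / 18)) ^ n

lemma sum_Icc_pow_le {q : ℝ} (hq0 : 0 ≤ q) (hq1 : q < 1) (T : ℕ) :
    ∑ n ∈ Finset.Icc 1 T, q ^ n ≤ q / (1 - q) := by
  have h1 : ∑ n ∈ Finset.Icc 1 T, q ^ n = (q - q ^ (T + 1)) / (1 - q) := by
    have : 1 - q ≠ 0 := by linarith
    induction T with
    | zero => simp
    | succ T ih =>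
      rw [Finset.sum_Icc_succ_top (by omega), ih]
      field_simp; ring
  have h2 : 0 ≤ q ^ (T + 1) := by positivity
  rw [h1]
  gcongr
  linarith

/-- For `M ≤ 10` the geometric tail is at most `18 / M ^ 2` and the logarithm has room for it, since
`10 * exp (1 / 2) < 17`. For `M > 10` the threshold is negative, the tail is below `0.007`, and the
logarithmic term is at least `-0.023`; here the `0.03` is needed. -/
lemma max_playThreshold_add_le {M : ℝ} (hM : 0 < M) :
    max (playThreshold M) 0 + 1 / (Real.exp (M ^ 2 / 18) - 1) ≤
      0.03 + 36 / M ^ 2 * Real.log (17 / M) := by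
  have hM2 : 0 < M ^ 2 := by positivity
  have he := Real.exp_one_lt_d9
  have he' := Real.exp_one_gt_d9
  have hlog36 : Real.log (36 / M ^ 2) = Real.log 36 - 2 * Real.log M := by
    rw [Real.log_div (by norm_num) hM2.ne', Real.log_pow]; norm_num
  have hlog17 : Real.log (17 / M) = Real.log 17 - Real.log M :=
    Real.log_div (by norm_num) hM.ne'
  by_cases h10 : M ≤ 10
  · have hx : Real.log M ≤ Real.log 10 := Real.log_le_log hM h10
    have h1 : 1 / (Real.exp (M ^ 2 / 18) - 1) ≤ 18 / M ^ 2 := by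
      have h2 := Real.add_one_le_exp (M ^ 2 / 18)
      rw [show 18 / M ^ 2 = 1 / (M ^ 2 / 18) by field_simp]
      exact one_div_le_one_div_of_le (by positivity) (by linarith)
    have hhalf : Real.exp (1 / 2) ≤ 1.7 := by
      have h7 : Real.exp (1 / 2) ^ 2 = Real.exp 1 := by rw [← Real.exp_nat_mul]; norm_num
      refine le_of_pow_le_pow_left₀ (n := 2) (by norm_num) (by norm_num) ?_
      rw [h7]; norm_num; linarith
    have h3 : Real.log 10 + 1 / 2 ≤ Real.log 17 := by
      rw [Real.le_log_iff_exp_le (by norm_num), Real.exp_add, Real.exp_log (by norm_num)]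
      linarith
    have h4 : Real.log 36 + 1 / 2 ≤ 2 * Real.log 17 := by
      rw [show 2 * Real.log 17 = Real.log (17 ^ 2) by rw [Real.log_pow]; norm_num,
        Real.le_log_iff_exp_le (by norm_num), Real.exp_add, Real.exp_log (by norm_num)]
      linarith
    have h5 : max (playThreshold M) 0 ≤ (36 * Real.log (17 / M) - 18) / M ^ 2 := by
      refine max_le ?_ (by apply div_nonneg _ hM2.le; rw [hlog17]; linarith)
      rw [playThreshold, hlog36, hlog17]
      gcongr
      linarith
    have h6 : (36 * Real.log (17 / M) - 18) / M ^ 2 + 18 / M ^ 2 =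
      36 / M ^ 2 * Real.log (17 / M) := by ring
    linarith
  · rw [not_le] at h10
    have h100 : 100 ≤ M ^ 2 := by nlinarith
    have h1 : max (playThreshold M) 0 = 0 := by
      refine max_eq_right ?_
      have h2 : Real.log (36 / M ^ 2) ≤ 0 :=
        Real.log_nonpos (by positivity) (by rw [div_le_one hM2]; linarith)
      exact div_nonpos_of_nonpos_of_nonneg (by linarith) hM2.le
    have h3 : 1 / (Real.exp (M ^ 2 / 18) - 1) ≤ 0.007 := by
      have h4 : Real.exp 5 ≤ Real.exp (M ^ 2 / 18) := Real.exp_le_exp.2 (by linarith)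
      have h5 := lt_exp_five
      rw [div_le_iff₀ (by linarith)]
      linarith
    have h6 : -0.023 ≤ 36 / M ^ 2 * Real.log (17 / M) := by
      -- The logarithmic term is smallest at `M ^ 2 = 289 * exp 1`, so the tangent is taken there.
      have hy : 0 < M ^ 2 / 289 / Real.exp 1 := by positivity
      have h7 := Real.log_le_sub_one_of_pos hy
      rw [Real.log_div (by positivity) (by positivity), Real.log_exp,
        Real.log_div (by positivity) (by norm_num), Real.log_pow,
        show (289 : ℝ) = 17 ^ 2 by norm_num, Real.log_pow] at h7
      push_cast at h7
      have h8 : M ^ 2 / 17 ^ 2 / Real.exp 1 ≤ M ^ 2 / 17 ^ 2 / 2.718 := by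
        gcongr; linarith
      have h9 : 36 / M ^ 2 * Real.log (17 / M) ≥ 36 / M ^ 2 * (-(M ^ 2 / 17 ^ 2 / 2.718) / 2) := by
        gcongr
        rw [hlog17]; linarith
      have h10 : 36 / M ^ 2 * (-(M ^ 2 / 17 ^ 2 / 2.718) / 2) = -(36 / 17 ^ 2 / 2.718 / 2) := by
        field_simp
      rw [h10] at h9
      norm_num at h9 ⊢
      linarith
    rw [h1]
    linarith

/-- Sizes below the threshold contribute one each, the others at most a geometric series. -/
lemma sum_upperTailBound_le {M : ℝ} (hM : 0 < M) (T : ℕ) :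
    ∑ n ∈ Finset.Icc 1 T, upperTailBound M n ≤ 0.03 + 36 / M ^ 2 * Real.log (17 / M) := by
  classical
  set q := Real.exp (-(M ^ 2 / 18)) with hq
  have hq1 : q < 1 := by
    rw [hq, ← Real.exp_zero, Real.exp_lt_exp]
    linarith [show 0 < M ^ 2 / 18 by positivity]
  have h1 : ∀ n, upperTailBound M n ≤ (if (n : ℝ) < playThreshold M then 1 else 0) + q ^ n := by
    intro n
    have : 0 ≤ q ^ n := by positivity
    rw [upperTailBound]
    split_ifs <;> linarith
  have h2 : ∑ n ∈ Finset.Icc 1 T, (if (n : ℝ) < playThreshold M then (1 : ℝ) else 0) ≤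
      max (playThreshold M) 0 := by
    rw [← Finset.sum_filter, Finset.sum_const, nsmul_one]
    have h3 : Finset.filter (fun n : ℕ => (n : ℝ) < playThreshold M) (Finset.Icc 1 T) ⊆
        Finset.Icc 1 ⌊max (playThreshold M) 0⌋₊ := by
      intro n hn
      simp only [Finset.mem_filter, Finset.mem_Icc] at hn ⊢
      exact ⟨hn.1.1, Nat.le_floor (hn.2.le.trans (le_max_left _ _))⟩
    have h4 := Finset.card_le_card h3
    rw [Nat.card_Icc, Nat.add_sub_cancel] at h4
    exact (Nat.cast_le.2 h4).trans (Nat.floor_le (le_max_right _ _))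
  have h5 : q / (1 - q) = 1 / (Real.exp (M ^ 2 / 18) - 1) := by
    have h6 : 1 < Real.exp (M ^ 2 / 18) := Real.one_lt_exp_iff.2 (by positivity)
    have h7 : Real.exp (M ^ 2 / 18) - 1 ≠ 0 := by linarith
    rw [hq, Real.exp_neg]
    field_simp
  calc ∑ n ∈ Finset.Icc 1 T, upperTailBound M n
      ≤ ∑ n ∈ Finset.Icc 1 T, ((if (n : ℝ) < playThreshold M then 1 else 0) + q ^ n) :=
        Finset.sum_le_sum fun n _ => h1 n
    _ ≤ max (playThreshold M) 0 + q / (1 - q) := by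
        rw [Finset.sum_add_distrib]
        exact add_le_add h2 (sum_Icc_pow_le (Real.exp_pos _).le hq1 T)
    _ ≤ _ := by rw [h5]; exact max_playThreshold_add_le hM

lemma measureReal_le_stoppedNoise_le {A D : ℕ} {Ω : Type*} [MeasurableSpace Ω]
    {env : BanditEnv A D} {η : Fin D → ℝ}
    {P : Measure Ω} [IsProbabilityMeasure P] {arm : ℕ → Ω → Fin A} {rew : ℕ → Ω → Fin D → ℝ}
    (hrun : IsNomLexRun env η P arm rew) (a : Fin A) (j : Fin D) (T : ℕ) {M : ℝ} (hM : 0 < M)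
    {n : ℕ} (hn : 1 ≤ n) :
    P.real {ω | n * (M - Real.sqrt (4 * Real.log n / n)) ≤
      stoppedNoise env (playHistory arm rew ω) a j n T} ≤ upperTailBound M n := by
  classical
  rw [upperTailBound]
  split_ifs with h1
  · exact measureReal_le_one
  · have hn' : (0 : ℝ) < n := by exact_mod_cast hn
    have h2 := sqrt_log_div_le hM hn (not_lt.1 h1)
    have h3 := (hrun.hasSubgaussianMGF_stoppedNoise a j n T).measure_ge_le (ε := n * (M / 3))
      (by positivity)
    refine (measureReal_mono fun ω hω => ?_).trans (h3.trans (le_of_eq ?_))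
    · refine le_trans ?_ (show _ ≤ stoppedNoise env (playHistory arm rew ω) a j n T from hω)
      gcongr
      linarith
    · rw [← Real.exp_nat_mul]
      congr 1
      push_cast; field_simp; ring

end Tails

/-! ### From tail bounds to expected plays and regret. -/

section Regret

variable {A D : ℕ}

lemma NomLex.exists_stoppedNoise_le {env : BanditEnv A D} {η : Fin D → ℝ} {b : Fin A}
    (hb : env.IsSatisficingOptimal η b) {h : ℕ → Fin A × (Fin D → ℝ)} {n t T : ℕ}
    (hn : NomLex.count h t b = n) (htT : t ≤ T) (hn0 : 0 < n)
    (hcand : b ∉ NomLex.candidates η h t) :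
    ∃ j, stoppedNoise env h b j n T ≤ -(n * Real.sqrt (4 * Real.log n / n)) := by
  simp only [NomLex.candidates, Finset.mem_filter, Finset.mem_univ, true_and, not_forall,
    not_lt, gt_iff_lt, hn] at hcand
  obtain ⟨j, hj⟩ := hcand
  refine ⟨j, ?_⟩
  rw [stoppedNoise_of_count_eq env b j hn htT hn0, ← mul_neg]
  have := hb j
  gcongr
  linarith

lemma NomLex.le_stoppedNoise {env : BanditEnv A D} {η : Fin D → ℝ} {a : Fin A}
    {h : ℕ → Fin A × (Fin D → ℝ)} {n t T : ℕ} (hn : NomLex.count h t a = n) (htT : t ≤ T)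
    (hn0 : 0 < n) (hcand : a ∈ NomLex.candidates η h t) (j : Fin D) :
    n * (η j - env.mean a j - Real.sqrt (4 * Real.log n / n)) ≤ stoppedNoise env h a j n T := by
  simp only [NomLex.candidates, Finset.mem_filter, Finset.mem_univ, true_and, gt_iff_lt,
    hn] at hcand
  have hj := hcand j
  rw [stoppedNoise_of_count_eq env a j hn htT hn0]
  exact mul_le_mul_of_nonneg_left (by linarith) n.cast_nonneg

variable {Ω : Type*} [MeasurableSpace Ω] {env : BanditEnv A D} {η : Fin D → ℝ} {P : Measure Ω}
  {arm : ℕ → Ω → Fin A} {rew : ℕ → Ω → Fin D → ℝ}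

lemma IsNomLexRun.integrable_count (hrun : IsNomLexRun env η P arm rew) [IsProbabilityMeasure P]
    (a : Fin A) (T : ℕ) :
    Integrable (fun ω => (NomLex.count (playHistory arm rew ω) T a : ℝ)) P := by
  have hm : Measurable fun ω => (NomLex.count (playHistory arm rew ω) T a : ℝ) :=
    measurable_from_nat.comp (measurable_count rew (fun s _ => hrun.measurable_arm s) a)
  refine Integrable.of_bound hm.aestronglyMeasurable T (Filter.Eventually.of_forall fun ω => ?_)
  rw [Real.norm_of_nonneg (by positivity)]
  exact_mod_cast NomLex.count_le a T

/-- The expected number of plays of an arm that misses the threshold of some objective `j` by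
`η j - μ_a^j > 0`. -/
lemma IsNomLexRun.integral_count_le (hrun : IsNomLexRun env η P arm rew) [IsProbabilityMeasure P]
    {star : Fin A} (hstar : env.IsSatisficingOptimal η star) (a : Fin A) (j : Fin D)
    (hj : 0 < η j - env.mean a j) (T : ℕ) :
    ∫ ω, (NomLex.count (playHistory arm rew ω) T a : ℝ) ∂P ≤
      Real.pi ^ 2 / 6 * D + 1 +
        36 / (η j - env.mean a j) ^ 2 * Real.log (17 / (η j - env.mean a j)) := by
  classical
  set M := η j - env.mean a j with hM
  set U : ℕ → Fin D → Set Ω := fun n i => {ω | stoppedNoise env (playHistory arm rew ω) star i n T ≤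
    -(n * Real.sqrt (4 * Real.log n / n))} with hU
  set V : ℕ → Set Ω := fun n => {ω | n * (M - Real.sqrt (4 * Real.log n / n)) ≤
    stoppedNoise env (playHistory arm rew ω) a j n T} with hV
  have hWm : ∀ b i n, Measurable fun ω => stoppedNoise env (playHistory arm rew ω) b i n T :=
    fun b i n => measurable_stoppedNoise env (fun s _ => hrun.measurable_arm s)
      (fun s _ => hrun.measurable_rew s) b i n
  have hUm : ∀ n i, MeasurableSet (U n i) := fun n i =>
    measurableSet_le (hWm star i n) measurable_const
  have hVm : ∀ n, MeasurableSet (V n) := fun n => measurableSet_le measurable_const (hWm a j n)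
  have hpt : ∀ᵐ ω ∂P, (NomLex.count (playHistory arm rew ω) T a : ℝ) ≤
      1 + (∑ n ∈ Finset.Icc 1 T, ∑ i, (U n i).indicator (fun _ => (1 : ℝ)) ω) +
        ∑ n ∈ Finset.Icc 1 T, (V n).indicator (fun _ => (1 : ℝ)) ω := by
    filter_upwards [hrun.ae_isConsistentAt] with ω hω
    have h1 : (NomLex.count (playHistory arm rew ω) T a : ℝ) ≤ _ :=
      Nat.cast_le.2 (NomLex.count_le_card_add_card (h := playHistory arm rew ω) hω a star T)
    refine h1.trans ?_
    rw [Finset.card_filter, Finset.card_filter]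
    push_cast
    have hind : ∀ S : Set Ω, 0 ≤ S.indicator (fun _ => (1 : ℝ)) ω := fun S =>
      Set.indicator_nonneg (fun _ _ => zero_le_one) ω
    gcongr with n hn n hn
    · split_ifs with h2
      · obtain ⟨t, ht, hnt, hc⟩ := h2
        obtain ⟨i, hi⟩ := NomLex.exists_stoppedNoise_le hstar hnt ht.le (Finset.mem_Icc.1 hn).1 hc
        have h3 : (U n i).indicator (fun _ => (1 : ℝ)) ω = 1 :=
          Set.indicator_of_mem (show ω ∈ U n i from hi) _
        refine h3.symm.le.trans ?_
        exact Finset.single_le_sum (f := fun i => (U n i).indicator (fun _ => (1 : ℝ)) ω)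
          (fun i _ => hind _) (Finset.mem_univ i)
      · exact Finset.sum_nonneg fun i _ => hind _
    · split_ifs with h2
      · obtain ⟨t, ht, hnt, hc⟩ := h2
        have h3 : ω ∈ V n := NomLex.le_stoppedNoise hnt ht.le (Finset.mem_Icc.1 hn).1 hc j
        exact (Set.indicator_of_mem h3 fun _ => (1 : ℝ)).ge
      · exact hind _
  have hUi : ∀ n i, Integrable (fun ω => (U n i).indicator (fun _ => (1 : ℝ)) ω) P := fun n i =>
    (integrable_const 1).indicator (hUm n i)
  have hVi : ∀ n, Integrable (fun ω => (V n).indicator (fun _ => (1 : ℝ)) ω) P := fun n =>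
    (integrable_const 1).indicator (hVm n)
  have hUs : Integrable (fun ω => ∑ n ∈ Finset.Icc 1 T, ∑ i,
      (U n i).indicator (fun _ => (1 : ℝ)) ω) P :=
    integrable_finsetSum _ fun n _ => integrable_finsetSum _ fun i _ => hUi n i
  have hVs : Integrable (fun ω => ∑ n ∈ Finset.Icc 1 T,
      (V n).indicator (fun _ => (1 : ℝ)) ω) P := integrable_finsetSum _ fun n _ => hVi n
  have h1U : Integrable (fun ω => 1 + ∑ n ∈ Finset.Icc 1 T, ∑ i,
      (U n i).indicator (fun _ => (1 : ℝ)) ω) P := (integrable_const 1).add hUs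
  -- With at least one objective, the saving `0.03 * D` for `star` pays the `0.03` lost for `a`.
  have hD : (1 : ℝ) ≤ D := by exact_mod_cast (j.pos : 0 < D)
  calc ∫ ω, (NomLex.count (playHistory arm rew ω) T a : ℝ) ∂P
      ≤ ∫ ω, (1 + (∑ n ∈ Finset.Icc 1 T, ∑ i, (U n i).indicator (fun _ => (1 : ℝ)) ω) +
        ∑ n ∈ Finset.Icc 1 T, (V n).indicator (fun _ => (1 : ℝ)) ω) ∂P :=
        integral_mono_ae (hrun.integrable_count a T) (h1U.add hVs) hpt
    _ = 1 + (∑ n ∈ Finset.Icc 1 T, ∑ i, P.real (U n i)) + ∑ n ∈ Finset.Icc 1 T, P.real (V n) := by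
        rw [integral_add h1U hVs, integral_add (integrable_const 1) hUs,
          integral_finsetSum _ fun n _ => integrable_finsetSum _ fun i _ => hUi n i,
          integral_finsetSum _ fun n _ => hVi n]
        congr 1
        · congr 1
          · simp
          · refine Finset.sum_congr rfl fun n _ => ?_
            rw [integral_finsetSum _ fun i _ => hUi n i]
            refine Finset.sum_congr rfl fun i _ => ?_
            rw [integral_indicator_const _ (hUm n i), smul_eq_mul, mul_one]
        · refine Finset.sum_congr rfl fun n _ => ?_
          rw [integral_indicator_const _ (hVm n), smul_eq_mul, mul_one]
    _ ≤ 1 + (∑ n ∈ Finset.Icc 1 T, ∑ _i : Fin D, lowerTailBound n) +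
        ∑ n ∈ Finset.Icc 1 T, upperTailBound M n := by
        gcongr with n hn i _ n hn
        · exact measureReal_stoppedNoise_le_neg_le hrun star i T (Finset.mem_Icc.1 hn).1
        · exact measureReal_le_stoppedNoise_le hrun a j T hj (Finset.mem_Icc.1 hn).1
    _ ≤ 1 + D * (Real.pi ^ 2 / 6 - 0.03) + (0.03 + 36 / M ^ 2 * Real.log (17 / M)) := by
        simp only [Finset.sum_const, Finset.card_univ, Fintype.card_fin, nsmul_eq_mul]
        rw [← Finset.mul_sum]
        gcongr
        · exact sum_lowerTailBound_le T
        · exact sum_upperTailBound_le hj T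
    _ ≤ _ := by linarith

namespace BanditEnv

lemma gap_sub_delta (env : BanditEnv A D) (η : Fin D → ℝ) (star a : Fin A) (i : Fin D) :
    env.gap star a i - env.delta η star i = η i - env.mean a i := by
  rw [gap, delta]; ring

lemma mem_nonSatisficing (env : BanditEnv A D) (η : Fin D → ℝ) (i : Fin D) (a : Fin A) :
    a ∈ env.nonSatisficing η i ↔ env.mean a i < η i := by
  simp [nonSatisficing, satisficing]

lemma satRegret_eq_sum (env : BanditEnv A D) (η : Fin D → ℝ) (star : Fin A) (i : Fin D) (T : ℕ)
    (h : ℕ → Fin A × (Fin D → ℝ)) :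
    env.satRegret η star i T (fun t => (h t).1) = ∑ a ∈ env.nonSatisficing η i,
      (env.gap star a i - env.delta η star i) * NomLex.count h T a := by
  simp only [satRegret, NomLex.count_eq_sum]
  push_cast
  simp only [Finset.mul_sum]
  rw [Finset.sum_comm]
  refine Finset.sum_congr rfl fun t _ => ?_
  simp only [mul_ite, mul_one, mul_zero, Finset.sum_ite_eq]

end BanditEnv

lemma IsNomLexRun.integral_satRegret (hrun : IsNomLexRun env η P arm rew) [IsProbabilityMeasure P]
    (star : Fin A) (i : Fin D) (T : ℕ) :
    ∫ ω, env.satRegret η star i T (fun t => arm t ω) ∂P = ∑ a ∈ env.nonSatisficing η i,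
      (env.gap star a i - env.delta η star i) *
        ∫ ω, (NomLex.count (playHistory arm rew ω) T a : ℝ) ∂P := by
  have h1 : ∀ ω, env.satRegret η star i T (fun t => arm t ω) = ∑ a ∈ env.nonSatisficing η i,
      (env.gap star a i - env.delta η star i) * NomLex.count (playHistory arm rew ω) T a :=
    fun ω => env.satRegret_eq_sum η star i T (playHistory arm rew ω)
  simp_rw [h1]
  rw [integral_finsetSum _ fun a _ => (hrun.integrable_count a T).const_mul _]
  exact Finset.sum_congr rfl fun a _ => integral_const_mul _ _

end Regret

theorem mainTheorem4 {A D : ℕ} (env : BanditEnv A D) (η : Fin D → ℝ) (star : Fin A)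
    (hstar : env.IsSatisficingOptimal η star)
    {Ω : Type*} [MeasurableSpace Ω] (P : Measure Ω) [IsProbabilityMeasure P]
    (arm : ℕ → Ω → Fin A) (rew : ℕ → Ω → Fin D → ℝ) (hrun : IsNomLexRun env η P arm rew)
    (i : Fin D) (T : ℕ) (hT : 1 ≤ T) :
    (∫ ω, env.satRegret η star i T (fun t => arm t ω) ∂P ≤
      ∑ a ∈ env.nonSatisficing η i,
        ((Real.pi ^ 2 / 6 * (D : ℝ) + 1) * (env.gap star a i - env.delta η star i)
          + 36 / env.maxGap η star a * max (Real.log (17 / env.maxGap η star a)) 0)) ∧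
    (D = 1 →
      ∫ ω, env.satRegret η star i T (fun t => arm t ω) ∂P ≤
        ∑ a ∈ env.nonSatisficing η i,
          ((Real.pi ^ 2 / 6 + 1) * (env.gap star a i - env.delta η star i)
            + 36 / (env.gap star a i - env.delta η star i)
              * Real.log (17 / (env.gap star a i - env.delta η star i)))) := by
  rw [hrun.integral_satRegret star i T]
  refine ⟨Finset.sum_le_sum fun a ha => ?_, fun hD => Finset.sum_le_sum fun a ha => ?_⟩
  · rw [env.mem_nonSatisficing] at ha
    have : Nonempty (Fin D) := ⟨i⟩
    -- The plays of `a` are bounded through the objective with the largest gap, whatever the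
    -- objective `i` of the regret.
    obtain ⟨j, hj⟩ := exists_eq_ciSup_of_finite
      (f := fun j : Fin D => env.gap star a j - env.delta η star j)
    have hle : env.gap star a i - env.delta η star i ≤ env.maxGap η star a :=
      le_ciSup (f := fun j : Fin D => env.gap star a j - env.delta η star j)
        (Set.finite_range _).bddAbove i
    have hMj : env.maxGap η star a = η j - env.mean a j := by
      rw [← env.gap_sub_delta η star a j]; exact hj.symm
    rw [env.gap_sub_delta] at hle ⊢
    have hg : 0 < η i - env.mean a i := by linarith
    have hM : 0 < env.maxGap η star a := hg.trans_le hle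
    have h1 := hrun.integral_count_le hstar a j (hMj ▸ hM) T
    rw [← hMj] at h1
    set M := env.maxGap η star a
    calc _ ≤ (η i - env.mean a i) *
          (Real.pi ^ 2 / 6 * D + 1 + 36 / M ^ 2 * Real.log (17 / M)) := by gcongr
      _ = (Real.pi ^ 2 / 6 * D + 1) * (η i - env.mean a i) +
          (η i - env.mean a i) * (36 / M ^ 2) * Real.log (17 / M) := by ring
      _ ≤ (Real.pi ^ 2 / 6 * D + 1) * (η i - env.mean a i) +
          M * (36 / M ^ 2) * max (Real.log (17 / M)) 0 := by
          -- Replacing the gap in objective `i` by the larger `M` is legitimate only against a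
          -- nonnegative factor, hence the positive part. For `D = 1` the two gaps coincide and
          -- nothing is replaced.
          refine add_le_add_right ?_ _
          calc (η i - env.mean a i) * (36 / M ^ 2) * Real.log (17 / M)
              ≤ (η i - env.mean a i) * (36 / M ^ 2) * max (Real.log (17 / M)) 0 := by
                gcongr; exact le_max_left _ _
            _ ≤ _ := by gcongr
      _ = _ := by
          congr 2
          field_simp
  · rw [env.mem_nonSatisficing] at ha
    rw [env.gap_sub_delta]
    have hg : 0 < η i - env.mean a i := by linarith
    have h1 := hrun.integral_count_le hstar a i hg T
    rw [show (D : ℝ) = 1 by exact_mod_cast hD, mul_one] at h1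
    calc _ ≤ (η i - env.mean a i) * (Real.pi ^ 2 / 6 + 1 +
          36 / (η i - env.mean a i) ^ 2 * Real.log (17 / (η i - env.mean a i))) := by gcongr
      _ = _ := by field_simp
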